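/- Let $K$ be a field (for instance $\mathbb C$), $N\ge 0$ an integer, $q\in K$ with $q\neq 0$ and $q^2\neq\pm1$, and $\lambda=q-q^{-1}$. Let $R$ be the standard Drinfeld–Jimbo matrix $$R^{i_1i_2}_{j_1j_2}=\delta^{i_1}_{j_1}\delta^{i_2}_{j_2}\bigl(1+(q-1)\delta^{i_1i_2}\bigr)+\lambda\,\delta^{i_1}_{j_2}\delta^{i_2}_{j_1}\Theta_{i_1i_2},\qquad \Theta_{ij}=1\text{ if }i>j,\ 0\text{ otherwise},$$ $\hat R=P_{12}R_{12}$ with $P_{12}$ the permutation matrix, $D^{-1}=\mathrm{diag}(q^{2(N-i)+1})_{i=1}^N$ and $Tr_q(X)=Tr(D^{-1}X)$. Let $\mathcal D$ be the associative unital $K$-algebra generated by the entries of the $N\times N$ matrices $T,T^{-1},L,L^{-1},\omega,J$ subject to $TT^{-1}=T^{-1}T=1$, $LL^{-1}=L^{-1}L=1$ and (with $X_1=X\otimes 1$, $X_2=1\otimes X$) $$\omega_2\hat R^{-1}\omega_2\hat R=-\hat R^{-1}\omega_2\hat R^{-1}\omega_2,\quad \omega_2\hat RL_2\hat R=\hat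 RL_2\hat R\omega_2,\quad \omega_2\hat RJ_2\hat R+\hat RJ_2\hat R\omega_2=-\hat R,$$ $$L_2\hat RL_2\hat R=\hat RL_2\hat RL_2,\quad J_2\hat RL_2\hat R=\hat RL_2\hat RJ_2,\quad J_2\hat RJ_2\hat R=-\hat R^{-1}J_2\hat RJ_2,$$ $$\hat RT_1T_2=T_1T_2\hat R,\quad \omega_1T_2=T_2\hat R^{-1}\omega_2\hat R^{-1},\quad J_1T_2=T_2\hat RJ_2\hat R,\quad L_1T_2=T_2\hat RL_2\hat R.$$ It is $\mathbb Z$-graded by $\deg T=\deg L=0$, $\deg\omega=1$, $\deg J=-1$. Put $W=1+\lambda\omega J$, $\overline W=1+\lambda J\omega$ and $$Q^*=\lambda^{-1}\bigl(Tr_q(JL^{-1}(1+\lambda J\omega))-Tr_q(J)\bigr).$$ Then $Q^*=Tr_q\bigl(J(L^{-1}-1)/\lambda+JL^{-1}J\omega\bigr)$, and $$(Q^*)^2=0,\qquad [Q^*,L]=0,\qquad [Q^*,T]=-q^{2N}\,TJ,\qquad [Q^*,J]_+=q^{2N}J^2,$$ $$[Q^*,\omega]_+=q^{2N}\Bigl(W\,\frac{1-L^{-1}}{\lambda}\,\overline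 W-\lambda\,\omega J^2\omega\Bigr).$$ Moreover $Q^*$ defines a differential $d^*$: there is a unique linear map $d^*:\mathcal D\to\mathcal D$ that has the following four properties: $d^*a=Q^*a-(-1)^n a\,Q^*$ for all $a$ homogeneous of degree $n$; $d^*\circ d^*=0$; $d^*(ab)=d^*(a)\,b+(-1)^n a\,d^*(b)$ for $a$ homogeneous of degree $n$ and all $b$; and $d^*$ lowers the degree by one. -/

import Mathlib

open scoped Kronecker

namespace QGL

section numeric

variable {K : Type*} [Field K] {N : ℕ}

/-- `λ = q - q⁻¹`. -/
def lam (q : K) : K := q - q⁻¹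

/-- The standard Drinfeld-Jimbo `R`-matrix of `GL_q(N)`; rows are indexed by the upper pair of
indices `(i₁, i₂)`, columns by the lower pair `(j₁, j₂)`. -/
def Rmat (q : K) : Matrix (Fin N × Fin N) (Fin N × Fin N) K :=
  Matrix.of fun i j =>
    (if i.1 = j.1 ∧ i.2 = j.2 then 1 + (q - 1) * (if i.1 = i.2 then 1 else 0) else 0)
      + lam q * (if i.1 = j.2 ∧ i.2 = j.1 then (if i.2 < i.1 then 1 else 0) else 0)

/-- The permutation matrix `P₁₂`. -/
def Pmat : Matrix (Fin N × Fin N) (Fin N × Fin N) K :=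
  Matrix.of fun i j => if i.1 = j.2 ∧ i.2 = j.1 then 1 else 0

/-- `R̂ = P₁₂ R₁₂`. -/
def Rhat (q : K) : Matrix (Fin N × Fin N) (Fin N × Fin N) K := Pmat * Rmat q

/-- The matrix `D⁻¹`, i.e. `diag(q^{2(N-i)+1})` for `i = 1, …, N`; here the index `i : Fin N`
starts at zero, so the `i`-th entry is `q^{2(N-(i+1))+1}`. -/
def Dinv (q : K) : Matrix (Fin N) (Fin N) K :=
  Matrix.diagonal fun i => q ^ (2 * (N - (i.val + 1)) + 1)

end numeric

section matrices

variable {K : Type*} [Field K] {N : ℕ} {A : Type*} [Ring A] [Algebra K A]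

/-- A numerical matrix, viewed as a matrix over a `K`-algebra `A`. -/
def num (A : Type*) [Ring A] [Algebra K A] {m : Type*} (M : Matrix m m K) : Matrix m m A :=
  M.map (algebraMap K A)

/-- `X₁ = X ⊗ 1`. -/
def in1 (X : Matrix (Fin N) (Fin N) A) : Matrix (Fin N × Fin N) (Fin N × Fin N) A := X ⊗ₖ 1

/-- `X₂ = 1 ⊗ X`. -/
def in2 (X : Matrix (Fin N) (Fin N) A) : Matrix (Fin N × Fin N) (Fin N × Fin N) A := 1 ⊗ₖ X

/-- The quantum trace `Tr_q(X) = Tr(D⁻¹ X)`. -/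
def trq (q : K) (X : Matrix (Fin N) (Fin N) A) : A := (num A (Dinv q) * X).trace

end matrices

/-- Generators: the entries of the matrices `T`, `T⁻¹`, `L`, `L⁻¹`, `ω`, `J`. -/
inductive Gen (N : ℕ) : Type
  | T (i j : Fin N)
  | Tinv (i j : Fin N)
  | L (i j : Fin N)
  | Linv (i j : Fin N)
  | om (i j : Fin N)
  | J (i j : Fin N)

/-- The degree: `T` and `L` have degree `0`, the forms `ω` degree `1`, the inner derivations `J`
degree `-1`. -/
def Gen.deg {N : ℕ} : Gen N → ℤ
  | .T _ _ => 0
  | .Tinv _ _ => 0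
  | .L _ _ => 0
  | .Linv _ _ => 0
  | .om _ _ => 1
  | .J _ _ => -1

section free

variable (K : Type*) [Field K] (N : ℕ)

def freeT : Matrix (Fin N) (Fin N) (FreeAlgebra K (Gen N)) :=
  Matrix.of fun i j => FreeAlgebra.ι K (Gen.T i j)

def freeTinv : Matrix (Fin N) (Fin N) (FreeAlgebra K (Gen N)) :=
  Matrix.of fun i j => FreeAlgebra.ι K (Gen.Tinv i j)

def freeL : Matrix (Fin N) (Fin N) (FreeAlgebra K (Gen N)) :=
  Matrix.of fun i j => FreeAlgebra.ι K (Gen.L i j)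

def freeLinv : Matrix (Fin N) (Fin N) (FreeAlgebra K (Gen N)) :=
  Matrix.of fun i j => FreeAlgebra.ι K (Gen.Linv i j)

def freeOm : Matrix (Fin N) (Fin N) (FreeAlgebra K (Gen N)) :=
  Matrix.of fun i j => FreeAlgebra.ι K (Gen.om i j)

def freeJ : Matrix (Fin N) (Fin N) (FreeAlgebra K (Gen N)) :=
  Matrix.of fun i j => FreeAlgebra.ι K (Gen.J i j)

/-- `R̂` as a matrix over the free algebra. -/
def freeR (q : K) : Matrix (Fin N × Fin N) (Fin N × Fin N) (FreeAlgebra K (Gen N)) :=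
  num (FreeAlgebra K (Gen N)) (Rhat q)

/-- `R̂⁻¹` as a matrix over the free algebra. -/
noncomputable def freeRinv (q : K) :
    Matrix (Fin N × Fin N) (Fin N × Fin N) (FreeAlgebra K (Gen N)) :=
  num (FreeAlgebra K (Gen N)) (Rhat q)⁻¹

end free

/-- The defining relations of the differential algebra over `GL_q(N)` (forms `ω`, inner
derivations `J`, vector fields `L`, functions `T`), entry by entry. -/
inductive Rel {K : Type*} [Field K] (N : ℕ) (q : K) :
    FreeAlgebra K (Gen N) → FreeAlgebra K (Gen N) → Prop
  /-- `ω₂ R̂⁻¹ ω₂ R̂ = - R̂⁻¹ ω₂ R̂⁻¹ ω₂` -/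
  | om_om (a b : Fin N × Fin N) : Rel N q
      ((in2 (freeOm K N) * freeRinv K N q * in2 (freeOm K N) * freeR K N q) a b)
      ((-(freeRinv K N q * in2 (freeOm K N) * freeRinv K N q * in2 (freeOm K N))) a b)
  /-- `ω₂ R̂ L₂ R̂ = R̂ L₂ R̂ ω₂` -/
  | om_L (a b : Fin N × Fin N) : Rel N q
      ((in2 (freeOm K N) * freeR K N q * in2 (freeL K N) * freeR K N q) a b)
      ((freeR K N q * in2 (freeL K N) * freeR K N q * in2 (freeOm K N)) a b)
  /-- `ω₂ R̂ J₂ R̂ + R̂ J₂ R̂ ω₂ = - R̂` -/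
  | om_J (a b : Fin N × Fin N) : Rel N q
      ((in2 (freeOm K N) * freeR K N q * in2 (freeJ K N) * freeR K N q
        + freeR K N q * in2 (freeJ K N) * freeR K N q * in2 (freeOm K N)) a b)
      ((-freeR K N q) a b)
  /-- `L₂ R̂ L₂ R̂ = R̂ L₂ R̂ L₂` -/
  | L_L (a b : Fin N × Fin N) : Rel N q
      ((in2 (freeL K N) * freeR K N q * in2 (freeL K N) * freeR K N q) a b)
      ((freeR K N q * in2 (freeL K N) * freeR K N q * in2 (freeL K N)) a b)
  /-- `J₂ R̂ L₂ R̂ = R̂ L₂ R̂ J₂` -/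
  | J_L (a b : Fin N × Fin N) : Rel N q
      ((in2 (freeJ K N) * freeR K N q * in2 (freeL K N) * freeR K N q) a b)
      ((freeR K N q * in2 (freeL K N) * freeR K N q * in2 (freeJ K N)) a b)
  /-- `J₂ R̂ J₂ R̂ = - R̂⁻¹ J₂ R̂ J₂` -/
  | J_J (a b : Fin N × Fin N) : Rel N q
      ((in2 (freeJ K N) * freeR K N q * in2 (freeJ K N) * freeR K N q) a b)
      ((-(freeRinv K N q * in2 (freeJ K N) * freeR K N q * in2 (freeJ K N))) a b)
  /-- `R̂ T₁ T₂ = T₁ T₂ R̂` -/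
  | T_T (a b : Fin N × Fin N) : Rel N q
      ((freeR K N q * in1 (freeT K N) * in2 (freeT K N)) a b)
      ((in1 (freeT K N) * in2 (freeT K N) * freeR K N q) a b)
  /-- `ω₁ T₂ = T₂ R̂⁻¹ ω₂ R̂⁻¹` -/
  | om_T (a b : Fin N × Fin N) : Rel N q
      ((in1 (freeOm K N) * in2 (freeT K N)) a b)
      ((in2 (freeT K N) * freeRinv K N q * in2 (freeOm K N) * freeRinv K N q) a b)
  /-- `J₁ T₂ = T₂ R̂ J₂ R̂` -/
  | J_T (a b : Fin N × Fin N) : Rel N q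
      ((in1 (freeJ K N) * in2 (freeT K N)) a b)
      ((in2 (freeT K N) * freeR K N q * in2 (freeJ K N) * freeR K N q) a b)
  /-- `L₁ T₂ = T₂ R̂ L₂ R̂` -/
  | L_T (a b : Fin N × Fin N) : Rel N q
      ((in1 (freeL K N) * in2 (freeT K N)) a b)
      ((in2 (freeT K N) * freeR K N q * in2 (freeL K N) * freeR K N q) a b)
  /-- `T T⁻¹ = 1` -/
  | T_Tinv (i j : Fin N) : Rel N q
      ((freeT K N * freeTinv K N) i j) ((1 : Matrix (Fin N) (Fin N) (FreeAlgebra K (Gen N))) i j)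
  /-- `T⁻¹ T = 1` -/
  | Tinv_T (i j : Fin N) : Rel N q
      ((freeTinv K N * freeT K N) i j) ((1 : Matrix (Fin N) (Fin N) (FreeAlgebra K (Gen N))) i j)
  /-- `L L⁻¹ = 1` -/
  | L_Linv (i j : Fin N) : Rel N q
      ((freeL K N * freeLinv K N) i j) ((1 : Matrix (Fin N) (Fin N) (FreeAlgebra K (Gen N))) i j)
  /-- `L⁻¹ L = 1` -/
  | Linv_L (i j : Fin N) : Rel N q
      ((freeLinv K N * freeL K N) i j) ((1 : Matrix (Fin N) (Fin N) (FreeAlgebra K (Gen N))) i j)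

/-- The differential algebra over `GL_q(N)`: the `K`-algebra with the above generators and
relations. -/
abbrev DiffAlg {K : Type*} [Field K] (N : ℕ) (q : K) : Type _ := RingQuot (Rel N q)

section alg

variable {K : Type*} [Field K] (N : ℕ) (q : K)

/-- The class of a generator in the differential algebra. -/
noncomputable def gen (g : Gen N) : DiffAlg N q :=
  RingQuot.mkAlgHom K (Rel N q) (FreeAlgebra.ι K g)

noncomputable def T : Matrix (Fin N) (Fin N) (DiffAlg N q) :=
  Matrix.of fun i j => gen N q (Gen.T i j)

noncomputable def L : Matrix (Fin N) (Fin N) (DiffAlg N q) :=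
  Matrix.of fun i j => gen N q (Gen.L i j)

noncomputable def Linv : Matrix (Fin N) (Fin N) (DiffAlg N q) :=
  Matrix.of fun i j => gen N q (Gen.Linv i j)

noncomputable def om : Matrix (Fin N) (Fin N) (DiffAlg N q) :=
  Matrix.of fun i j => gen N q (Gen.om i j)

noncomputable def J : Matrix (Fin N) (Fin N) (DiffAlg N q) :=
  Matrix.of fun i j => gen N q (Gen.J i j)

/-- `W = 1 + λ ω J`. -/
noncomputable def W : Matrix (Fin N) (Fin N) (DiffAlg N q) := 1 + lam q • (om N q * J N q)

/-- `W̄ = 1 + λ J ω`. -/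
noncomputable def Wbar : Matrix (Fin N) (Fin N) (DiffAlg N q) := 1 + lam q • (J N q * om N q)

/-- `Θ* = J L⁻¹ (1 + λ J ω)`. -/
noncomputable def ThetaStar : Matrix (Fin N) (Fin N) (DiffAlg N q) :=
  J N q * Linv N q * (1 + lam q • (J N q * om N q))

/-- The anti-BRST operator `Q* = λ⁻¹ (Tr_q(Θ*) - Tr_q(J))`. -/
noncomputable def Qstar : DiffAlg N q :=
  (lam q)⁻¹ • (trq q (ThetaStar N q) - trq q (J N q))

/-- The homogeneous elements of degree `n`: the span of the words in the generators of total
degree `n`. -/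
noncomputable def homog (n : ℤ) : Submodule K (DiffAlg N q) :=
  Submodule.span K {x | ∃ w : List (Gen N), (w.map Gen.deg).sum = n ∧ x = (w.map (gen N q)).prod}

end alg

end QGL

/-! Write `Θ*` for `ThetaStar`, so that `λQ* = Tr_q(Θ*) - Tr_q(J)`. The proof turns exchange
relations between matrices into commutation relations with quantum traces, by applying the partial
quantum trace over the first tensor factor. Matrices `X₂` come out of that trace on either side,
without any assumption that entries commute, and two numerical identities evaluate the rest:
`Tr_q₁(R̂) = q^{2N}` and `Tr_q₁(R̂ X₂ R̂) = Tr_q(X) + λ q^{2N} X`. By the Hecke condition `R̂⁻¹ = R̂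
- λ`, the second gives `Tr_q₁(R̂^{±1} X₂ R̂^{∓1}) = Tr_q(X)` (`ptr_RA_in2_SA`, `ptr_SA_in2_RA`).

The input is how `Θ*` passes through `L`, `J`, `ω`, `T` and itself. The first three and the last
follow from computations in any algebra containing an element with the Hecke property (`hecke_lΘ`,
`hecke_jΘ`, `hecke_wΘ`, `hecke_ΘΘ`). `Tr_q(Θ*)` commutes with `L` and `T` and anticommutes with `J`,
so the right-hand sides for `T` and `J` come from `Tr_q(J)` alone; for `ω` both traces contribute.

`Θ*` satisfies the same odd reflection equation as `J`, and the quantum trace of any solution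
squares to zero (`trq_mul_self_eq_zero`). As the two traces also anticommute, `(Q*)² = 0`.

The differential is `a ↦ Q* a - σ(a) Q*` with `σ` the parity automorphism. Uniqueness holds because
homogeneous elements span. -/

namespace QGL

/-! ### Numerical identities for the R-matrix and the weights of the quantum trace -/

section numeric

variable {K : Type*} [Field K] {N : ℕ}

theorem Rhat_apply (q : K) (a b c d : Fin N) :
    Rhat q (a, b) (c, d) =
      (if a = d ∧ b = c then (if a = b then q else 1) else 0)
        + (if a = c ∧ b = d ∧ a < b then lam q else 0) := by
  have h : Rhat q (a, b) (c, d) = Rmat q (b, a) (c, d) := by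
    simp only [Rhat, Pmat, Matrix.mul_apply, Matrix.of_apply, ite_mul, one_mul, zero_mul]
    rw [Finset.sum_eq_single (b, a)]
    · simp
    · rintro ⟨x, y⟩ - hxy
      rw [if_neg]
      rintro ⟨h1, h2⟩
      exact hxy (by simp_all)
    · simp
  rw [h]
  simp only [Rmat, Matrix.of_apply]
  congr 1
  · by_cases hab : a = b
    · subst hab; simp [and_comm]
    · have : ¬ b = a := fun h => hab h.symm
      simp [hab, this, and_comm]
  · by_cases h1 : a = c <;> by_cases h2 : b = d <;> by_cases h3 : a < b <;> simp [h1, h2, h3]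

/-- The sum telescopes: consecutive weights have ratio `q⁻²`, and `q - q⁻¹ = λ`, so raising `b` by
one loses in the first term exactly what the sum gains. At the lowest index only `q · q^{2N-1}` is
left. -/
theorem sum_Dinv_lt {q : K} (hq0 : q ≠ 0) (b : Fin N) :
    q * q ^ (2 * (N - (b.val + 1)) + 1)
      + lam q * ∑ a : Fin N, (if a < b then q ^ (2 * (N - (a.val + 1)) + 1) else 0)
      = q ^ (2 * N) := by
  have key : ∀ k : ℕ, k < N → q * q ^ (2 * (N - (k + 1)) + 1)
      + lam q * ∑ a ∈ Finset.range k, q ^ (2 * (N - (a + 1)) + 1) = q ^ (2 * N) := by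
    intro k
    induction k with
    | zero =>
      intro h
      obtain ⟨m, rfl⟩ : ∃ m, N = m + 1 := ⟨N - 1, by omega⟩
      simp; ring
    | succ k ih =>
      intro h
      rw [← ih (by omega), Finset.sum_range_succ]
      obtain ⟨m, rfl⟩ : ∃ m, N = k + 1 + 1 + m := ⟨N - (k + 2), by omega⟩
      have h1 : k + 1 + 1 + m - (k + 1 + 1) = m := by omega
      have h2 : k + 1 + 1 + m - (k + 1) = m + 1 := by omega
      rw [h1, h2]
      simp only [lam]
      field_simp
      ring
  rw [← key b.val b.isLt]
  congr 2
  rw [← Finset.sum_filter, Finset.filter_gt_eq_Iio, ← Nat.Iio_eq_range,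
    ← Fin.map_valEmbedding_Iio, Finset.sum_map]
  rfl

theorem lam_ne_zero {q : K} (hq0 : q ≠ 0) (hq1 : q ^ 2 ≠ 1) : lam q ≠ 0 := by
  intro h
  apply hq1
  have h1 : q = q⁻¹ := sub_eq_zero.mp h
  calc q ^ 2 = q * q := sq q
    _ = q * q⁻¹ := by rw [← h1]
    _ = 1 := mul_inv_cancel₀ hq0

/-- The quantity is `(q + q⁻¹)²`. It appears as the determinant of the linear system behind
nilpotency. -/
theorem lam_sq_add_four_ne_zero {q : K} (hq0 : q ≠ 0) (hq2 : q ^ 2 ≠ -1) :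
    lam q ^ 2 + 4 ≠ 0 := by
  have h : lam q ^ 2 + 4 = (q⁻¹ * (q ^ 2 + 1)) ^ 2 := by
    simp only [lam]
    field_simp
    ring
  rw [h]
  refine pow_ne_zero _ (mul_ne_zero (inv_ne_zero hq0) fun h => hq2 ?_)
  linear_combination h

/-- A row of `R̂` has at most two nonzero entries. With `F` arbitrary, the same collapse serves the
Hecke condition and the partial trace of `R̂ X₂ R̂`. -/
theorem sum_Rhat_mul (q : K) (a b e : Fin N) (F : Fin N → K) :
    ∑ c, Rhat q (a, b) (c, e) * F c
      = (if a = e then (if a = b then q else 1) * F b else 0)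
        + (if b = e ∧ a < b then lam q * F a else 0) := by
  simp only [Rhat_apply, add_mul, Finset.sum_add_distrib]
  congr 1
  · rw [Finset.sum_eq_single b] <;> aesop
  · rw [Finset.sum_eq_single a] <;> aesop

/-- The Hecke condition `R̂² = 1 + λ R̂`. -/
theorem Rhat_sq {q : K} (hq0 : q ≠ 0) :
    Rhat q * Rhat q = (1 : Matrix (Fin N × Fin N) (Fin N × Fin N) K) + lam q • Rhat q := by
  have hq : q * q = 1 + lam q * q := by simp only [lam]; field_simp; ring
  ext ⟨a, b⟩ ⟨g, d⟩
  have h : ∀ e, ∑ c, Rhat q (a, b) (c, e) * Rhat q (c, e) (g, d) = _ :=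
    fun e => sum_Rhat_mul q a b e fun c => Rhat q (c, e) (g, d)
  rw [Matrix.mul_apply, Fintype.sum_prod_type_right, Finset.sum_congr rfl fun e _ => h e,
    Finset.sum_add_distrib, Finset.sum_eq_single a (by aesop) (by simp),
    Finset.sum_eq_single b (by aesop) (by simp)]
  simp only [Rhat_apply, Matrix.add_apply, Matrix.smul_apply, Matrix.one_apply, smul_eq_mul,
    Prod.mk.injEq, if_true, true_and]
  clear h
  grind

theorem Rhat_mul_sub {q : K} (hq0 : q ≠ 0) :
    Rhat q * (Rhat q - lam q • (1 : Matrix (Fin N × Fin N) (Fin N × Fin N) K)) = 1 := by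
  rw [mul_sub, Rhat_sq hq0]
  simp

theorem Rhat_inv {q : K} (hq0 : q ≠ 0) :
    (Rhat q)⁻¹ = Rhat q - lam q • (1 : Matrix (Fin N × Fin N) (Fin N × Fin N) K) :=
  Matrix.inv_eq_right_inv (Rhat_mul_sub hq0)

/-- The diagonal entries of `D⁻¹`. -/
def wt (q : K) (i : Fin N) : K := q ^ (2 * (N - (i.val + 1)) + 1)

/-- `R̂` only links index pairs that agree up to order, so it commutes with `D⁻¹ ⊗ D⁻¹`. This makes
the double quantum trace cyclic with respect to `R̂`. -/
theorem wt_mul_Rhat (q : K) (x y : Fin N × Fin N) :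
    wt q x.1 * wt q x.2 * Rhat q x y = Rhat q x y * (wt q y.1 * wt q y.2) := by
  obtain ⟨a, b⟩ := x
  obtain ⟨c, d⟩ := y
  rw [Rhat_apply]
  by_cases h1 : a = d ∧ b = c
  · obtain ⟨rfl, rfl⟩ := h1
    ring
  · by_cases h2 : a = c ∧ b = d ∧ a < b
    · obtain ⟨rfl, rfl, -⟩ := h2
      ring
    · simp [h1, h2]

theorem sum_wt_mul_Rhat {q : K} (hq0 : q ≠ 0) (b d : Fin N) :
    ∑ a, wt q a * Rhat q (a, b) (a, d) = if b = d then q ^ (2 * N) else 0 := by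
  simp only [Rhat_apply]
  by_cases h : b = d
  · subst h
    rw [if_pos rfl, ← sum_Dinv_lt hq0 b, Finset.mul_sum]
    simp only [mul_add, Finset.sum_add_distrib]
    congr 1
    · rw [Finset.sum_eq_single b]
      · simp [wt, mul_comm]
      · intro c _ hc; simp [hc]
      · simp
    · refine Finset.sum_congr rfl fun a _ => ?_
      by_cases hab : a < b <;> simp [hab, wt, mul_comm]
  · refine (Finset.sum_eq_zero fun a _ => ?_).trans (if_neg h).symm
    aesop

/-- This is the coefficient of `X e f` in the entry `(b, d)` of `Tr_q₁(R̂ X₂ R̂)`. -/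
theorem sum_wt_mul_Rhat_mul_Rhat {q : K} (hq0 : q ≠ 0) (b d e f : Fin N) :
    ∑ a, ∑ c, wt q a * (Rhat q (a, b) (c, e) * Rhat q (c, f) (a, d))
      = (if b = d ∧ e = f then wt q e else 0)
        + (if b = e ∧ f = d then lam q * q ^ (2 * N) else 0) := by
  have h : ∀ a, ∑ c, Rhat q (a, b) (c, e) * Rhat q (c, f) (a, d) = _ :=
    fun a => sum_Rhat_mul q a b e fun c => Rhat q (c, f) (a, d)
  rw [Finset.sum_congr rfl fun a _ => by rw [← Finset.mul_sum, h, mul_add],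
    Finset.sum_add_distrib, Finset.sum_eq_single e (by aesop) (by simp)]
  by_cases hb : b = e ∧ f = d
  · obtain ⟨rfl, rfl⟩ := hb
    have h2 : ∀ a, wt q a * (if b = b ∧ a < b then lam q * Rhat q (a, f) (a, f) else 0)
        = (if a = f ∧ f < b then lam q * q * wt q f else 0)
          + lam q ^ 2 * (if a < b ∧ a < f then wt q a else 0) := by
      intro a
      rw [Rhat_apply]
      grind
    rw [Finset.sum_congr rfl fun a _ => h2 a, Finset.sum_add_distrib]
    have h1 : ∑ a, (if a = f ∧ f < b then lam q * q * wt q f else 0)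
        = if f < b then lam q * q * wt q f else 0 := by
      rw [Finset.sum_eq_single f (by aesop) (by simp)]
      simp
    rw [h1, ← Finset.mul_sum]
    -- The hypothesis on `x` makes it the minimum of `b` and `f`. The three cases below differ only
    -- in which index that is; for `b = f` the Hecke relation `q² = 1 + λq` supplies the extra `wt q
    -- b`.
    have hs : ∀ x : Fin N, (∀ a : Fin N, a < x ↔ a < b ∧ a < f) → q * wt q x
        + lam q * ∑ a : Fin N, (if a < b ∧ a < f then wt q a else 0) = q ^ (2 * N) := by
      intro x hx
      rw [← sum_Dinv_lt hq0 x]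
      simp only [← hx, wt]
    have hq : q * q = 1 + lam q * q := by simp only [lam]; field_simp; ring
    rw [Rhat_apply]
    rcases lt_trichotomy b f with h | rfl | h
    · have h3 := hs b (by grind)
      have h4 := h.ne
      have h5 := h.not_gt
      simp [h, h4, h4.symm, h5]
      linear_combination lam q * h3
    · have h3 := hs b (by grind)
      simp only [and_self] at h3
      simp
      linear_combination lam q * h3 + wt q b * hq
    · have h3 := hs f (by grind)
      have h4 := h.ne
      have h5 := h.not_gt
      simp [h, h4, h4.symm, h5]
      linear_combination lam q * h3
  · have h2 : ∀ a, wt q a * (if b = e ∧ a < b then lam q * Rhat q (a, f) (a, d) else 0) = 0 := by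
      intro a
      rw [Rhat_apply]
      grind
    rw [Finset.sum_congr rfl fun a _ => h2 a, Finset.sum_const_zero, Rhat_apply]
    clear h h2
    grind

end numeric
end QGL
namespace QGL
-- Exchange relations derived in an abstract algebra with a Hecke element
section hecke

variable {K M : Type*} [Field K] [Ring M] [Algebra K M] {c : K} {R S w j l l' V Θ : M}

/-- The reflection equation rewrites `jRj` as `-RjRjR`, after which the mixed relation moves `w` to
the left. Its inhomogeneous term `-R` yields `cRj`, which matches the Hecke correction in `RRj`. -/
theorem hecke_jV (hRR : R * R = 1 + c • R) (hS : S = R - c • (1 : M)) (hV : V = 1 + c • (j * w))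
    (hjj : j * R * j * R = -(S * j * R * j)) (hwj : w * R * j * R + R * j * R * w = -R) :
    j * R * V * S = R * V * R * j := by
  have hRR' : ∀ x, R * (R * x) = x + c • (R * x) := fun x => by
    rw [← mul_assoc, hRR, add_mul, one_mul, smul_mul_assoc]
  subst hS hV
  linear_combination (norm := skip)
    -(c • (R * j * hwj * (R - c • (1 : M)))) + c • (R * hjj * (w * (R - c • (1 : M))))
  simp only [mul_add, add_mul, mul_sub, sub_mul, mul_neg, neg_mul, mul_smul_comm, smul_mul_assoc,
    mul_one, one_mul, mul_assoc, hRR, hRR', smul_add, smul_sub, smul_neg]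
  module

theorem hecke_wV (hRR : R * R = 1 + c • R) (hS : S = R - c • (1 : M)) (hV : V = 1 + c • (j * w))
    (hww : w * S * w * R = -(S * w * S * w)) (hwj : w * R * j * R + R * j * R * w = -R) :
    w * R * V * R = R * V * S * w := by
  have hRR' : ∀ x, R * (R * x) = x + c • (R * x) := fun x => by
    rw [← mul_assoc, hRR, add_mul, one_mul, smul_mul_assoc]
  subst hS hV
  linear_combination (norm := skip)
    c • (hwj * ((R - c • (1 : M)) * w * R)) - c • (R * j * R * hww)
  simp only [mul_add, add_mul, mul_sub, sub_mul, mul_neg, neg_mul, mul_smul_comm, smul_mul_assoc,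
    mul_one, one_mul, mul_assoc, hRR, hRR', smul_add, smul_sub, smul_neg]
  module

/-- The hypothesis says that `x` commutes with `RlR`, hence with its inverse `Sl'S`. -/
theorem comm_inv {x : M} (hRS : R * S = 1) (hSR : S * R = 1) (hl : l * l' = 1) (hl' : l' * l = 1)
    (h : x * R * l * R = R * l * R * x) : x * S * l' * S = S * l' * S * x := by
  have h1 : R * l * R * (S * l' * S) = 1 := by
    calc R * l * R * (S * l' * S) = R * (l * (R * S) * l') * S := by simp only [mul_assoc]
      _ = 1 := by rw [hRS, mul_one, hl, mul_one, hRS]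
  have h2 : S * l' * S * (R * l * R) = 1 := by
    calc S * l' * S * (R * l * R) = S * (l' * (S * R) * l) * R := by simp only [mul_assoc]
      _ = 1 := by rw [hSR, mul_one, hl', mul_one, hSR]
  calc x * S * l' * S = (S * l' * S * (R * l * R)) * (x * S * l' * S) := by rw [h2, one_mul]
    _ = S * l' * S * ((R * l * R * x) * (S * l' * S)) := by simp only [mul_assoc]
    _ = S * l' * S * (x * (R * l * R * (S * l' * S))) := by rw [← h]; simp only [mul_assoc]
    _ = S * l' * S * x := by rw [h1, mul_one]

/-- All of `j`, `w`, `l` commute with `RlR`, so `Θ`, being built from `j`, `w` and `l'`, does too.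
-/
theorem hecke_lΘ (hRS : R * S = 1) (hSR : S * R = 1) (hl : l * l' = 1) (hl' : l' * l = 1)
    (hV : V = 1 + c • (j * w)) (hΘ : Θ = j * l' * V)
    (hll : l * R * l * R = R * l * R * l) (hjl : j * R * l * R = R * l * R * j)
    (hwl : w * R * l * R = R * l * R * w) :
    l * R * Θ * S = S * Θ * R * l := by
  have cj : Commute j (R * l * R) := by simpa only [Commute, SemiconjBy, mul_assoc] using hjl
  have cw : Commute w (R * l * R) := by simpa only [Commute, SemiconjBy, mul_assoc] using hwl
  have cl : Commute l (R * l * R) := by simpa only [Commute, SemiconjBy, mul_assoc] using hll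
  have cl' : Commute l' (R * l * R) := by
    have : Commute ((⟨l, l', hl, hl'⟩ : Mˣ) : M) (R * l * R) := cl
    exact this.units_inv_left
  have cΘ : Commute Θ (R * l * R) := by
    rw [hΘ, hV]
    exact (cj.mul_left cl').mul_left
      ((Commute.one_left _).add_left ((cj.mul_left cw).smul_left c))
  calc l * R * Θ * S = (S * R) * l * R * Θ * S := by rw [hSR, one_mul]
    _ = S * (R * l * R * Θ) * S := by simp only [mul_assoc]
    _ = S * (Θ * (R * l * R)) * S := by rw [cΘ.eq]
    _ = S * Θ * R * l * (R * S) := by simp only [mul_assoc]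
    _ = S * Θ * R * l := by rw [hRS, mul_one]

theorem hecke_inv_lΘ (hl : l * l' = 1) (hl' : l' * l = 1)
    (h : l * R * Θ * S = S * Θ * R * l) : l' * S * Θ * R = R * Θ * S * l' := by
  calc l' * S * Θ * R = l' * (S * Θ * R * l) * l' := by simp only [mul_assoc, hl, mul_one]
    _ = (l' * l) * R * Θ * S * l' := by rw [← h]; simp only [mul_assoc]
    _ = R * Θ * S * l' := by rw [hl', one_mul]

/-- `j` is carried past the factors `j`, `l'`, `V` of `Θ` in turn; only the first passage changes
the sign. -/
theorem hecke_jΘ (hRS : R * S = 1) (hSR : S * R = 1) (hΘ : Θ = j * l' * V)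
    (hjj : j * R * j * R = -(S * j * R * j)) (hjl' : j * S * l' * S = S * l' * S * j)
    (hjV : j * R * V * S = R * V * R * j) :
    j * R * Θ * S = -(S * Θ * R * j) := by
  have hRS' : ∀ x, R * (S * x) = x := fun x => by rw [← mul_assoc, hRS, one_mul]
  have hSR' : ∀ x, S * (R * x) = x := fun x => by rw [← mul_assoc, hSR, one_mul]
  subst hΘ
  linear_combination (norm := skip)
    hjj * (S * l' * V * S) - S * j * R * hjl' * (R * V * S) - S * j * l' * S * hjV
  simp only [neg_mul, mul_assoc, hRS', hSR']
  abel

/-- `w` is carried past `j`, `l'`, `V` in turn. The term `-l'VR` is what the constant `-R` of the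
mixed relation leaves at the first passage. -/
theorem hecke_wΘ (hRS : R * S = 1) (hSR : S * R = 1) (hΘ : Θ = j * l' * V)
    (hwj : w * R * j * R + R * j * R * w = -R) (hwl' : w * S * l' * S = S * l' * S * w)
    (hwV : w * R * V * R = R * V * S * w) :
    w * R * Θ * R = -(l' * V * R) - R * Θ * S * w := by
  have hRS' : ∀ x, R * (S * x) = x := fun x => by rw [← mul_assoc, hRS, one_mul]
  have hSR' : ∀ x, S * (R * x) = x := fun x => by rw [← mul_assoc, hSR, one_mul]
  subst hΘ
  linear_combination (norm := skip)
    hwj * (S * l' * V * R) - R * j * R * hwl' * (R * V * R) - R * j * l' * S * hwV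
  simp only [add_mul, neg_mul, mul_assoc, hRS', hSR']
  abel

/-- Split the left `Θ` as `jl' + c jl'jw`. Moving `jl'` past `Θ` requires replacing `R` by `S + c`,
which costs `c jl'ΘR`; the inhomogeneous term met by `w` contributes exactly the opposite. -/
theorem hecke_ΘΘ (hS : S = R - c • (1 : M)) (hV : V = 1 + c • (j * w)) (hΘ : Θ = j * l' * V)
    (hl'Θ : l' * S * Θ * R = R * Θ * S * l') (hjΘ : j * R * Θ * S = -(S * Θ * R * j))
    (hwΘ : w * R * Θ * R = -(l' * V * R) - R * Θ * S * w) :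
    Θ * R * Θ * R = -(S * Θ * R * Θ) := by
  have hΘ' : Θ = j * l' + c • (j * l' * j * w) := by
    rw [hΘ, hV, mul_add, mul_one, mul_smul_comm, ← mul_assoc]
  have h1 : j * l' * R * Θ * R = -(S * Θ * R * j * l') + c • (j * l' * Θ * R) := by
    have : R = S + c • (1 : M) := by rw [hS]; abel
    calc j * l' * R * Θ * R = j * (l' * (S + c • (1 : M)) * Θ * R) := by
          rw [← this]; simp only [mul_assoc]
      _ = j * (l' * S * Θ * R) + c • (j * l' * Θ * R) := by
          simp only [mul_add, add_mul, mul_smul_comm, smul_mul_assoc, mul_one, mul_assoc]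
      _ = (j * R * Θ * S) * l' + c • (j * l' * Θ * R) := by rw [hl'Θ]; simp only [mul_assoc]
      _ = _ := by rw [hjΘ]; simp only [neg_mul]
  have h2 : j * l' * j * R * Θ * S * w = S * Θ * R * j * l' * j * w * (-1) * (-1) := by
    calc j * l' * j * R * Θ * S * w = j * l' * (j * R * Θ * S) * w := by simp only [mul_assoc]
      _ = -(j * (l' * S * Θ * R) * j * w) := by
          rw [hjΘ]; simp only [mul_neg, neg_mul, mul_assoc]
      _ = -((j * R * Θ * S) * l' * j * w) := by rw [hl'Θ]; simp only [mul_assoc]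
      _ = _ := by rw [hjΘ]; simp
  have h2 : j * l' * j * R * Θ * S * w = S * Θ * R * j * l' * j * w := by simpa using h2
  have h3 : j * l' * j * (w * R * Θ * R) = -(j * l' * Θ * R) - S * Θ * R * j * l' * j * w := by
    rw [hwΘ, ← h2, hΘ]
    simp only [mul_sub, mul_neg, mul_assoc]
  calc Θ * R * Θ * R = (j * l' + c • (j * l' * j * w)) * R * Θ * R := by rw [← hΘ']
    _ = j * l' * R * Θ * R + c • (j * l' * j * (w * R * Θ * R)) := by
        simp only [add_mul, smul_mul_assoc, mul_assoc]
    _ = -(S * Θ * R * (j * l' + c • (j * l' * j * w))) := by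
        rw [h1, h3]
        simp only [mul_add, mul_smul_comm, smul_sub, smul_neg, mul_assoc]
        abel
    _ = _ := by rw [← hΘ']
end hecke

end QGL
namespace QGL

/-! ### Partial and double quantum traces over a noncommutative algebra -/

section ptrace

variable {K : Type*} [Field K] {N : ℕ} {A : Type*} [Ring A] [Algebra K A]

theorem in2_apply (X : Matrix (Fin N) (Fin N) A) (a b c d : Fin N) :
    in2 X (a, b) (c, d) = if a = c then X b d else 0 := by
  simp [in2, Matrix.one_apply]

theorem in1_apply (X : Matrix (Fin N) (Fin N) A) (a b c d : Fin N) :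
    in1 X (a, b) (c, d) = if b = d then X a c else 0 := by
  simp [in1, Matrix.one_apply]

theorem in1_mul (X Y : Matrix (Fin N) (Fin N) A) : in1 (X * Y) = in1 X * in1 Y := by
  ext ⟨a, b⟩ ⟨c, d⟩
  simp only [Matrix.mul_apply, Fintype.sum_prod_type, in1_apply, ite_mul, mul_ite, zero_mul,
    mul_zero]
  by_cases h : b = d <;> simp [h]

theorem in1_add (X Y : Matrix (Fin N) (Fin N) A) : in1 (X + Y) = in1 X + in1 Y :=
  Matrix.add_kronecker _ _ _

theorem in1_one : in1 (1 : Matrix (Fin N) (Fin N) A) = 1 := Matrix.one_kronecker_one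

theorem in1_smul (r : K) (X : Matrix (Fin N) (Fin N) A) : in1 (r • X) = r • in1 X :=
  Matrix.smul_kronecker _ _ _

theorem in2_mul (X Y : Matrix (Fin N) (Fin N) A) : in2 (X * Y) = in2 X * in2 Y := by
  ext ⟨a, b⟩ ⟨c, d⟩
  simp only [Matrix.mul_apply, Fintype.sum_prod_type, in2_apply, ite_mul, mul_ite, zero_mul,
    mul_zero]
  by_cases h : a = c <;> simp [h]

theorem in2_add (X Y : Matrix (Fin N) (Fin N) A) : in2 (X + Y) = in2 X + in2 Y :=
  Matrix.kronecker_add _ _ _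

theorem in2_one : in2 (1 : Matrix (Fin N) (Fin N) A) = 1 := Matrix.one_kronecker_one

theorem in2_smul (r : K) (X : Matrix (Fin N) (Fin N) A) : in2 (r • X) = r • in2 X :=
  Matrix.kronecker_smul _ _ _

theorem trq_eq_sum (q : K) (X : Matrix (Fin N) (Fin N) A) : trq q X = ∑ a, wt q a • X a a := by
  simp [trq, num, Matrix.trace, Dinv, Matrix.diagonal_map, wt, Algebra.smul_def]

theorem trq_add (q : K) (X Y : Matrix (Fin N) (Fin N) A) : trq q (X + Y) = trq q X + trq q Y := by
  simp [trq_eq_sum, Finset.sum_add_distrib]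

theorem trq_sub (q : K) (X Y : Matrix (Fin N) (Fin N) A) : trq q (X - Y) = trq q X - trq q Y := by
  simp [trq_eq_sum, smul_sub]

theorem trq_neg (q : K) (X : Matrix (Fin N) (Fin N) A) : trq q (-X) = -trq q X := by
  simp [trq_eq_sum]

theorem trq_smul (q r : K) (X : Matrix (Fin N) (Fin N) A) : trq q (r • X) = r • trq q X := by
  simp only [trq_eq_sum, Finset.smul_sum, Matrix.smul_apply]
  exact Finset.sum_congr rfl fun a _ => smul_comm _ _ _

/-- The scalar matrix with the entry `t` on the diagonal. -/
def scal (N : ℕ) (t : A) : Matrix (Fin N) (Fin N) A := Matrix.diagonal fun _ => t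

theorem trq_mul_scal (q : K) (X : Matrix (Fin N) (Fin N) A) (t : A) :
    trq q (X * scal N t) = trq q X * t := by
  simp [trq_eq_sum, scal, Finset.sum_mul]

theorem trq_scal_mul (q : K) (X : Matrix (Fin N) (Fin N) A) (t : A) :
    trq q (scal N t * X) = t * trq q X := by
  simp [trq_eq_sum, scal, Finset.mul_sum]

/-- The partial quantum trace over the first factor. -/
def ptr (q : K) :
    Matrix (Fin N × Fin N) (Fin N × Fin N) A →ₗ[K] Matrix (Fin N) (Fin N) A where
  toFun M := Matrix.of fun b d => ∑ a, wt q a • M (a, b) (a, d)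
  map_add' X Y := by ext; simp [Finset.sum_add_distrib]
  map_smul' r X := by
    ext
    simp only [Matrix.smul_apply, Matrix.of_apply, Finset.smul_sum, RingHom.id_apply]
    exact Finset.sum_congr rfl fun a _ => smul_comm _ _ _

theorem ptr_apply (q : K) (M : Matrix (Fin N × Fin N) (Fin N × Fin N) A) (b d : Fin N) :
    ptr q M b d = ∑ a, wt q a • M (a, b) (a, d) := rfl

theorem ptr_in2_mul (q : K) (X : Matrix (Fin N) (Fin N) A)
    (M : Matrix (Fin N × Fin N) (Fin N × Fin N) A) : ptr q (in2 X * M) = X * ptr q M := by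
  ext b d
  simp only [ptr_apply, Matrix.mul_apply, Fintype.sum_prod_type, in2_apply, ite_mul, zero_mul]
  simp only [Finset.mul_sum, mul_smul_comm]
  rw [Finset.sum_comm]
  refine Finset.sum_congr rfl fun a _ => ?_
  rw [Finset.sum_comm]
  simp [Finset.smul_sum]

theorem ptr_mul_in2 (q : K) (X : Matrix (Fin N) (Fin N) A)
    (M : Matrix (Fin N × Fin N) (Fin N × Fin N) A) : ptr q (M * in2 X) = ptr q M * X := by
  ext b d
  simp only [ptr_apply, Matrix.mul_apply, Fintype.sum_prod_type, in2_apply, mul_ite, mul_zero]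
  simp only [Finset.sum_mul, smul_mul_assoc]
  rw [Finset.sum_comm]
  refine Finset.sum_congr rfl fun a _ => ?_
  rw [Finset.sum_comm]
  simp [Finset.smul_sum]

theorem ptr_in1_mul_in2 (q : K) (X Y : Matrix (Fin N) (Fin N) A) :
    ptr q (in1 X * in2 Y) = scal N (trq q X) * Y := by
  ext b d
  rw [scal, Matrix.diagonal_mul]
  simp [ptr_apply, Matrix.mul_apply, Fintype.sum_prod_type, in2_apply, in1_apply,
    trq_eq_sum, Finset.sum_mul]

/-- `R̂` over the algebra `A`. -/
def RA (A : Type*) [Ring A] [Algebra K A] (N : ℕ) (q : K) :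
    Matrix (Fin N × Fin N) (Fin N × Fin N) A := num A (Rhat q)

/-- `R̂⁻¹` over the algebra `A`. -/
noncomputable def SA (A : Type*) [Ring A] [Algebra K A] (N : ℕ) (q : K) :
    Matrix (Fin N × Fin N) (Fin N × Fin N) A := num A (Rhat q)⁻¹

theorem num_eq_mapMatrix {m : Type*} [Fintype m] [DecidableEq m] (M : Matrix m m K) :
    num A M = (Algebra.ofId K A).mapMatrix M := rfl

variable {q : K}

theorem SA_eq (hq0 : q ≠ 0) : SA A N q = RA A N q - lam q • 1 := by
  rw [SA, RA, Rhat_inv hq0]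
  simp only [num_eq_mapMatrix, map_sub, map_smul, map_one]

theorem RA_mul_RA (hq0 : q ≠ 0) : RA A N q * RA A N q = 1 + lam q • RA A N q := by
  simp only [RA, num_eq_mapMatrix, ← map_mul, Rhat_sq hq0, map_add, map_smul, map_one]

theorem RA_mul_SA (hq0 : q ≠ 0) : RA A N q * SA A N q = 1 := by
  rw [SA_eq hq0, mul_sub, RA_mul_RA hq0]; simp

theorem SA_mul_RA (hq0 : q ≠ 0) : SA A N q * RA A N q = 1 := by
  rw [SA_eq hq0, sub_mul, RA_mul_RA hq0]; simp

theorem ptr_RA (hq0 : q ≠ 0) : ptr q (RA A N q) = q ^ (2 * N) • 1 := by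
  ext b d
  have h : ∀ a, wt q a • RA A N q (a, b) (a, d)
      = algebraMap K A (wt q a * Rhat q (a, b) (a, d)) := fun a => by
    rw [Algebra.smul_def, map_mul]; rfl
  rw [ptr_apply, Finset.sum_congr rfl fun a _ => h a, ← map_sum, sum_wt_mul_Rhat hq0]
  by_cases hb : b = d <;> simp [hb, Algebra.smul_def]

theorem ptr_RA_in2_RA (hq0 : q ≠ 0) (X : Matrix (Fin N) (Fin N) A) :
    ptr q (RA A N q * in2 X * RA A N q)
      = scal N (trq q X) + (lam q * q ^ (2 * N)) • X := by
  ext b d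
  have h1 : ∀ a, (RA A N q * in2 X * RA A N q) (a, b) (a, d)
      = ∑ f, ∑ e, ∑ c, (Rhat q (a, b) (c, e) * Rhat q (c, f) (a, d)) • X e f := fun a => by
    rw [Matrix.mul_apply, Fintype.sum_prod_type_right]
    refine Finset.sum_congr rfl fun f _ => ?_
    rw [Finset.sum_comm]
    refine Finset.sum_congr rfl fun c _ => ?_
    rw [Matrix.mul_apply, Fintype.sum_prod_type_right, Finset.sum_mul]
    refine Finset.sum_congr rfl fun e _ => ?_
    rw [Finset.sum_eq_single c]
    · rw [in2_apply, if_pos rfl, mul_smul, Algebra.smul_def, Algebra.smul_def,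
        Algebra.commutes (Rhat q (c, f) (a, d)), ← mul_assoc]
      rfl
    · intro c' _ hc
      rw [in2_apply, if_neg hc, mul_zero]
    · simp
  rw [ptr_apply, Finset.sum_congr rfl fun a _ => by rw [h1 a]]
  have h2 : ∑ a, wt q a • ∑ f, ∑ e, ∑ c, (Rhat q (a, b) (c, e) * Rhat q (c, f) (a, d)) • X e f
      = ∑ f, ∑ e, (∑ a, ∑ c, wt q a * (Rhat q (a, b) (c, e) * Rhat q (c, f) (a, d))) • X e f := by
    simp only [Finset.smul_sum, Finset.sum_smul, mul_smul]
    rw [Finset.sum_comm]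
    refine Finset.sum_congr rfl fun f _ => ?_
    rw [Finset.sum_comm]
  rw [h2]
  simp only [sum_wt_mul_Rhat_mul_Rhat hq0, add_smul, Finset.sum_add_distrib, ite_smul, zero_smul]
  simp only [Matrix.add_apply, Matrix.smul_apply, scal, Matrix.diagonal_apply, trq_eq_sum]
  congr 1
  · by_cases h : b = d <;> simp [h]
  · rw [Finset.sum_eq_single d, Finset.sum_eq_single b] <;> aesop

theorem ptr_in2_mul_RA (hq0 : q ≠ 0) (X : Matrix (Fin N) (Fin N) A) :
    ptr q (in2 X * RA A N q) = q ^ (2 * N) • X := by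
  rw [ptr_in2_mul, ptr_RA hq0]; simp

theorem ptr_RA_mul_in2 (hq0 : q ≠ 0) (X : Matrix (Fin N) (Fin N) A) :
    ptr q (RA A N q * in2 X) = q ^ (2 * N) • X := by
  rw [ptr_mul_in2, ptr_RA hq0]; simp

/-- Replacing one `R̂` by `R̂ - λ` removes precisely the term `λ q^{2N} X`. -/
theorem ptr_RA_in2_SA (hq0 : q ≠ 0) (X : Matrix (Fin N) (Fin N) A) :
    ptr q (RA A N q * in2 X * SA A N q) = scal N (trq q X) := by
  rw [SA_eq hq0, mul_sub, map_sub, ptr_RA_in2_RA hq0, mul_smul_comm, mul_one, map_smul,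
    ptr_RA_mul_in2 hq0, smul_smul, add_sub_cancel_right]

theorem ptr_SA_in2_RA (hq0 : q ≠ 0) (X : Matrix (Fin N) (Fin N) A) :
    ptr q (SA A N q * in2 X * RA A N q) = scal N (trq q X) := by
  rw [SA_eq hq0, sub_mul, sub_mul, map_sub, ptr_RA_in2_RA hq0, smul_mul_assoc, one_mul,
    smul_mul_assoc, map_smul, ptr_in2_mul_RA hq0, smul_smul, add_sub_cancel_right]

/-- The quantum trace over both factors. -/
def tr12 (q : K) (M : Matrix (Fin N × Fin N) (Fin N × Fin N) A) : A := trq q (ptr q M)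

theorem tr12_eq_sum (M : Matrix (Fin N × Fin N) (Fin N × Fin N) A) :
    tr12 q M = ∑ x : Fin N × Fin N, (wt q x.1 * wt q x.2) • M x x := by
  rw [tr12, trq_eq_sum, Fintype.sum_prod_type_right]
  refine Finset.sum_congr rfl fun b _ => ?_
  rw [ptr_apply, Finset.smul_sum]
  refine Finset.sum_congr rfl fun a _ => ?_
  rw [smul_smul, mul_comm]

theorem tr12_RA_mul (M : Matrix (Fin N × Fin N) (Fin N × Fin N) A) :
    tr12 q (RA A N q * M) = tr12 q (M * RA A N q) := by
  simp only [tr12_eq_sum, Matrix.mul_apply, Finset.smul_sum]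
  rw [Finset.sum_comm]
  refine Finset.sum_congr rfl fun x _ => Finset.sum_congr rfl fun y _ => ?_
  have h1 : RA A N q y x = algebraMap K A (Rhat q y x) := rfl
  rw [h1, ← Algebra.commutes (Rhat q y x) (M x y), ← Algebra.smul_def, smul_smul, smul_smul,
    wt_mul_Rhat, mul_comm]

theorem tr12_add (X Y : Matrix (Fin N × Fin N) (Fin N × Fin N) A) :
    tr12 q (X + Y) = tr12 q X + tr12 q Y := by
  simp only [tr12, map_add, trq_add]

theorem tr12_neg (X : Matrix (Fin N × Fin N) (Fin N × Fin N) A) :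
    tr12 q (-X) = -tr12 q X := by
  simp only [tr12, map_neg, trq_neg]

theorem tr12_smul (r : K) (X : Matrix (Fin N × Fin N) (Fin N × Fin N) A) :
    tr12 q (r • X) = r • tr12 q X := by
  simp only [tr12, map_smul, trq_smul]

/-- Nilpotency of the quantum trace of a reflection-equation odd matrix. -/
theorem trq_mul_self_eq_zero (hq0 : q ≠ 0) (hq1 : q ^ 2 ≠ 1) (hq2 : q ^ 2 ≠ -1)
    (X : Matrix (Fin N) (Fin N) A)
    (h : in2 X * RA A N q * in2 X * RA A N q = -(SA A N q * in2 X * RA A N q * in2 X)) :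
    trq q X * trq q X = 0 := by
  set Y := in2 X * RA A N q * in2 X with hY
  set R := RA A N q with hR
  have e0 : SA A N q * in2 X * R * in2 X = SA A N q * Y := by rw [hY]; simp only [mul_assoc]
  rw [e0] at h
  -- With `t` and `u` the double traces of `Y` and `YR̂`, cyclicity and the Hecke condition turn
  -- this identity into `2t + λu = 0`; the form `YR̂ = -R̂Y + λY` gives `2u = λt`.
  have h1 : R * (Y * R) = -Y := by
    rw [h, mul_neg, ← mul_assoc, RA_mul_SA hq0, one_mul]
  have h2 : tr12 q Y + lam q • tr12 q (Y * R) = -tr12 q Y := by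
    have := congrArg (tr12 q) h1
    rwa [tr12_RA_mul, mul_assoc, RA_mul_RA hq0, mul_add, mul_one, mul_smul_comm, tr12_add,
      tr12_smul, tr12_neg] at this
  have h3 : tr12 q (Y * R) = -tr12 q (Y * R) + lam q • tr12 q Y := by
    have h4 : Y * R = -(R * Y) + lam q • Y := by
      rw [h, SA_eq hq0, sub_mul, smul_mul_assoc, one_mul]; abel
    have := congrArg (tr12 q) h4
    rwa [tr12_add, tr12_neg, tr12_RA_mul, tr12_smul] at this
  have h5 : (lam q ^ 2 + 4) • tr12 q Y = 0 := by
    linear_combination (norm := module) (2 : K) • h2 - lam q • h3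
  have h6 : tr12 q Y = 0 := (smul_eq_zero_iff_right (lam_sq_add_four_ne_zero hq0 hq2)).mp h5
  -- Here `λu = 0` is divided by `λ` rather than `2u = 0` by `2`, so characteristic two is covered.
  have h7 : tr12 q (Y * R) = 0 := by
    rw [h6, zero_add, neg_zero] at h2
    exact (smul_eq_zero_iff_right (lam_ne_zero hq0 hq1)).mp h2
  have h8 : tr12 q (Y * SA A N q) = 0 := by
    rw [SA_eq hq0, mul_sub, mul_smul_comm, mul_one, sub_eq_add_neg, ← neg_smul, tr12_add,
      tr12_smul, h6, h7, smul_zero, add_zero]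
  -- In this grouping the inner partial trace is the scalar `Tr_q X`, so the double trace is `(Tr_q
  -- X)²`.
  have h9 : Y * SA A N q = in2 X * (R * in2 X * SA A N q) := by rw [hY]; simp only [mul_assoc]
  rwa [h9, tr12, ptr_in2_mul, ptr_RA_in2_SA hq0, trq_mul_scal] at h8

end ptrace
end QGL
namespace QGL

/-! ### The defining relations as matrix identities in the differential algebra -/

section relations

variable {K : Type*} [Field K] {N : ℕ} {A B : Type*} [Ring A] [Algebra K A] [Ring B] [Algebra K B]

theorem mapMatrix_in2 (f : A →ₐ[K] B) (X : Matrix (Fin N) (Fin N) A) :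
    f.mapMatrix (in2 X) = in2 (f.mapMatrix X) := by
  ext ⟨a, b⟩ ⟨c, d⟩
  simp only [AlgHom.mapMatrix_apply, Matrix.map_apply, in2_apply]
  split_ifs <;> simp

theorem mapMatrix_in1 (f : A →ₐ[K] B) (X : Matrix (Fin N) (Fin N) A) :
    f.mapMatrix (in1 X) = in1 (f.mapMatrix X) := by
  ext ⟨a, b⟩ ⟨c, d⟩
  simp only [AlgHom.mapMatrix_apply, Matrix.map_apply, in1_apply]
  split_ifs <;> simp

theorem mapMatrix_num {m : Type*} [Fintype m] [DecidableEq m] (f : A →ₐ[K] B) (M : Matrix m m K) :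
    f.mapMatrix (num A M) = num B M := by
  ext a b
  simp [num]

theorem mapMatrix_freeR (f : FreeAlgebra K (Gen N) →ₐ[K] B) (q : K) :
    f.mapMatrix (freeR K N q) = RA B N q := mapMatrix_num f _

theorem mapMatrix_freeRinv (f : FreeAlgebra K (Gen N) →ₐ[K] B) (q : K) :
    f.mapMatrix (freeRinv K N q) = SA B N q := mapMatrix_num f _

variable (N) (q : K)

/-- The class of the generators `T⁻¹`. -/
noncomputable def Tinv : Matrix (Fin N) (Fin N) (DiffAlg N q) :=
  Matrix.of fun i j => gen N q (Gen.Tinv i j)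

/-- The quotient map onto the differential algebra. -/
noncomputable def mk : FreeAlgebra K (Gen N) →ₐ[K] DiffAlg N q := RingQuot.mkAlgHom K (Rel N q)

theorem mapMatrix_eq_of_rel {m : Type*} [Fintype m] [DecidableEq m]
    {X Y : Matrix m m (FreeAlgebra K (Gen N))}
    (h : ∀ a b, Rel N q (X a b) (Y a b)) :
    (mk N q).mapMatrix X = (mk N q).mapMatrix Y := by
  ext a b
  exact RingQuot.mkAlgHom_rel K (h a b)

theorem mk_freeT : (mk N q).mapMatrix (freeT K N) = T N q := rfl
theorem mk_freeTinv : (mk N q).mapMatrix (freeTinv K N) = Tinv N q := rfl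
theorem mk_freeL : (mk N q).mapMatrix (freeL K N) = L N q := rfl
theorem mk_freeLinv : (mk N q).mapMatrix (freeLinv K N) = Linv N q := rfl
theorem mk_freeOm : (mk N q).mapMatrix (freeOm K N) = om N q := rfl
theorem mk_freeJ : (mk N q).mapMatrix (freeJ K N) = J N q := rfl

local notation "RR" => RA (DiffAlg N q) N q
local notation "SS" => SA (DiffAlg N q) N q

theorem om_om_rel : in2 (om N q) * SS * in2 (om N q) * RR
    = -(SS * in2 (om N q) * SS * in2 (om N q)) := by
  simpa only [map_mul, map_neg, mapMatrix_in2, mapMatrix_freeR, mapMatrix_freeRinv, mk_freeOm]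
    using mapMatrix_eq_of_rel N q Rel.om_om

theorem om_L_rel : in2 (om N q) * RR * in2 (L N q) * RR
    = RR * in2 (L N q) * RR * in2 (om N q) := by
  simpa only [map_mul, mapMatrix_in2, mapMatrix_freeR, mk_freeOm, mk_freeL]
    using mapMatrix_eq_of_rel N q Rel.om_L

theorem om_J_rel : in2 (om N q) * RR * in2 (J N q) * RR
    + RR * in2 (J N q) * RR * in2 (om N q) = -RR := by
  simpa only [map_mul, map_add, map_neg, mapMatrix_in2, mapMatrix_freeR, mk_freeOm, mk_freeJ]
    using mapMatrix_eq_of_rel N q Rel.om_J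

theorem L_L_rel : in2 (L N q) * RR * in2 (L N q) * RR
    = RR * in2 (L N q) * RR * in2 (L N q) := by
  simpa only [map_mul, mapMatrix_in2, mapMatrix_freeR, mk_freeL]
    using mapMatrix_eq_of_rel N q Rel.L_L

theorem J_L_rel : in2 (J N q) * RR * in2 (L N q) * RR
    = RR * in2 (L N q) * RR * in2 (J N q) := by
  simpa only [map_mul, mapMatrix_in2, mapMatrix_freeR, mk_freeJ, mk_freeL]
    using mapMatrix_eq_of_rel N q Rel.J_L

theorem J_J_rel : in2 (J N q) * RR * in2 (J N q) * RR
    = -(SS * in2 (J N q) * RR * in2 (J N q)) := by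
  simpa only [map_mul, map_neg, mapMatrix_in2, mapMatrix_freeR, mapMatrix_freeRinv, mk_freeJ]
    using mapMatrix_eq_of_rel N q Rel.J_J

theorem T_T_rel : RR * in1 (T N q) * in2 (T N q) = in1 (T N q) * in2 (T N q) * RR := by
  simpa only [map_mul, mapMatrix_in1, mapMatrix_in2, mapMatrix_freeR, mk_freeT]
    using mapMatrix_eq_of_rel N q Rel.T_T

theorem om_T_rel : in1 (om N q) * in2 (T N q) = in2 (T N q) * SS * in2 (om N q) * SS := by
  simpa only [map_mul, mapMatrix_in1, mapMatrix_in2, mapMatrix_freeRinv, mk_freeT, mk_freeOm]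
    using mapMatrix_eq_of_rel N q Rel.om_T

theorem J_T_rel : in1 (J N q) * in2 (T N q) = in2 (T N q) * RR * in2 (J N q) * RR := by
  simpa only [map_mul, mapMatrix_in1, mapMatrix_in2, mapMatrix_freeR, mk_freeT, mk_freeJ]
    using mapMatrix_eq_of_rel N q Rel.J_T

theorem L_T_rel : in1 (L N q) * in2 (T N q) = in2 (T N q) * RR * in2 (L N q) * RR := by
  simpa only [map_mul, mapMatrix_in1, mapMatrix_in2, mapMatrix_freeR, mk_freeT, mk_freeL]
    using mapMatrix_eq_of_rel N q Rel.L_T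

theorem T_mul_Tinv : T N q * Tinv N q = 1 := by
  simpa only [map_mul, map_one, mk_freeT, mk_freeTinv] using mapMatrix_eq_of_rel N q Rel.T_Tinv

theorem Tinv_mul_T : Tinv N q * T N q = 1 := by
  simpa only [map_mul, map_one, mk_freeT, mk_freeTinv] using mapMatrix_eq_of_rel N q Rel.Tinv_T

theorem L_mul_Linv : L N q * Linv N q = 1 := by
  simpa only [map_mul, map_one, mk_freeL, mk_freeLinv] using mapMatrix_eq_of_rel N q Rel.L_Linv

theorem Linv_mul_L : Linv N q * L N q = 1 := by
  simpa only [map_mul, map_one, mk_freeL, mk_freeLinv] using mapMatrix_eq_of_rel N q Rel.Linv_L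

end relations

/-! ### Commutation of the two quantum traces with the generators -/

section commutation

variable {K : Type*} [Field K] {N : ℕ} {q : K}

local notation "RR" => RA (DiffAlg N q) N q
local notation "SS" => SA (DiffAlg N q) N q

theorem in2_Wbar : in2 (Wbar N q) = 1 + lam q • (in2 (J N q) * in2 (om N q)) := by
  rw [Wbar, in2_add, in2_one, in2_smul, in2_mul]

theorem in2_ThetaStar :
    in2 (ThetaStar N q) = in2 (J N q) * in2 (Linv N q) * in2 (Wbar N q) := by
  rw [ThetaStar, in2_mul, in2_mul, Wbar]

theorem in2_L_mul_Linv : in2 (L N q) * in2 (Linv N q) = 1 := by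
  rw [← in2_mul, L_mul_Linv, in2_one]

theorem in2_Linv_mul_L : in2 (Linv N q) * in2 (L N q) = 1 := by
  rw [← in2_mul, Linv_mul_L, in2_one]

theorem L_ThetaStar (hq0 : q ≠ 0) : in2 (L N q) * RR * in2 (ThetaStar N q) * SS
    = SS * in2 (ThetaStar N q) * RR * in2 (L N q) :=
  hecke_lΘ (RA_mul_SA hq0) (SA_mul_RA hq0) in2_L_mul_Linv in2_Linv_mul_L in2_Wbar in2_ThetaStar
    (L_L_rel N q) (J_L_rel N q) (om_L_rel N q)

theorem J_ThetaStar (hq0 : q ≠ 0) : in2 (J N q) * RR * in2 (ThetaStar N q) * SS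
    = -(SS * in2 (ThetaStar N q) * RR * in2 (J N q)) :=
  hecke_jΘ (RA_mul_SA hq0) (SA_mul_RA hq0) in2_ThetaStar (J_J_rel N q)
    (comm_inv (RA_mul_SA hq0) (SA_mul_RA hq0) in2_L_mul_Linv in2_Linv_mul_L (J_L_rel N q))
    (hecke_jV (RA_mul_RA hq0) (SA_eq hq0) in2_Wbar (J_J_rel N q) (om_J_rel N q))

theorem om_ThetaStar (hq0 : q ≠ 0) : in2 (om N q) * RR * in2 (ThetaStar N q) * RR
    = -(in2 (Linv N q) * in2 (Wbar N q) * RR) - RR * in2 (ThetaStar N q) * SS * in2 (om N q) :=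
  hecke_wΘ (RA_mul_SA hq0) (SA_mul_RA hq0) in2_ThetaStar (om_J_rel N q)
    (comm_inv (RA_mul_SA hq0) (SA_mul_RA hq0) in2_L_mul_Linv in2_Linv_mul_L (om_L_rel N q))
    (hecke_wV (RA_mul_RA hq0) (SA_eq hq0) in2_Wbar (om_om_rel N q) (om_J_rel N q))

theorem ThetaStar_ThetaStar (hq0 : q ≠ 0) :
    in2 (ThetaStar N q) * RR * in2 (ThetaStar N q) * RR
      = -(SS * in2 (ThetaStar N q) * RR * in2 (ThetaStar N q)) :=
  hecke_ΘΘ (SA_eq hq0) in2_Wbar in2_ThetaStar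
    (hecke_inv_lΘ in2_L_mul_Linv in2_Linv_mul_L (L_ThetaStar hq0)) (J_ThetaStar hq0)
    (om_ThetaStar hq0)

theorem Linv_T_rel (hq0 : q ≠ 0) :
    in1 (Linv N q) * in2 (T N q) = in2 (T N q) * SS * in2 (Linv N q) * SS := by
  have hRS : RR * SS = 1 := RA_mul_SA hq0
  have h1 : in1 (Linv N q) * in1 (L N q) = 1 := by rw [← in1_mul, Linv_mul_L, in1_one]
  calc in1 (Linv N q) * in2 (T N q)
      = in1 (Linv N q) * in2 (T N q) * RR * (in2 (L N q) * (RR * SS) * in2 (Linv N q)) * SS := by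
        rw [hRS, mul_one, in2_L_mul_Linv, mul_one, mul_assoc, hRS, mul_one]
    _ = in1 (Linv N q) * (in2 (T N q) * RR * in2 (L N q) * RR) * SS * in2 (Linv N q) * SS := by
        simp only [mul_assoc]
    _ = (in1 (Linv N q) * in1 (L N q)) * in2 (T N q) * SS * in2 (Linv N q) * SS := by
        rw [← L_T_rel]; simp only [mul_assoc]
    _ = _ := by rw [h1, one_mul]

/-- Past `T₂`, `J` is dressed as `R̂ · R̂`, `L⁻¹` as `R̂⁻¹ · R̂⁻¹` and `W̄` as `R̂ · R̂⁻¹`. The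
inner factors cancel, leaving the dressing whose partial trace is a scalar. -/
theorem ThetaStar_T_rel (hq0 : q ≠ 0) :
    in1 (ThetaStar N q) * in2 (T N q) = in2 (T N q) * RR * in2 (ThetaStar N q) * SS := by
  have hRS : RR * SS = 1 := RA_mul_SA hq0
  have hRS' : ∀ x, RR * (SS * x) = x := fun x => by rw [← mul_assoc, hRS, one_mul]
  have h1 : in1 (J N q) * in1 (om N q) * in2 (T N q)
      = in2 (T N q) * RR * (in2 (J N q) * in2 (om N q)) * SS := by
    rw [mul_assoc, om_T_rel, ← mul_assoc, ← mul_assoc, ← mul_assoc, J_T_rel]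
    simp only [mul_assoc, hRS']
  have h2 : in1 (Wbar N q) * in2 (T N q) = in2 (T N q) * RR * in2 (Wbar N q) * SS := by
    rw [in2_Wbar, Wbar, in1_add, in1_one, in1_smul, in1_mul]
    simp only [add_mul, mul_add, smul_mul_assoc, mul_smul_comm, one_mul, mul_one, h1]
    rw [mul_assoc (in2 (T N q)) RR SS, hRS, mul_one]
  have h3 : ThetaStar N q = J N q * Linv N q * Wbar N q := rfl
  calc in1 (ThetaStar N q) * in2 (T N q)
      = in1 (J N q) * (in1 (Linv N q) * (in1 (Wbar N q) * in2 (T N q))) := by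
        rw [h3, in1_mul, in1_mul]; simp only [mul_assoc]
    _ = in1 (J N q) * (in1 (Linv N q) * in2 (T N q)) * RR * in2 (Wbar N q) * SS := by
        rw [h2]; simp only [mul_assoc]
    _ = (in1 (J N q) * in2 (T N q)) * SS * in2 (Linv N q) * SS * RR * in2 (Wbar N q) * SS := by
        rw [Linv_T_rel hq0]; simp only [mul_assoc]
    _ = in2 (T N q) * RR * in2 (J N q) * (RR * SS) * in2 (Linv N q) * (SS * RR)
          * in2 (Wbar N q) * SS := by
        rw [J_T_rel]; simp only [mul_assoc]
    _ = _ := by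
        rw [hRS, SA_mul_RA hq0, mul_one, mul_one, in2_ThetaStar]; simp only [mul_assoc]

local notation "tΘ" => scal N (trq q (ThetaStar N q))
local notation "tJ" => scal N (trq q (J N q))

theorem ThetaStar_L_comm (hq0 : q ≠ 0) : L N q * tΘ = tΘ * L N q := by
  have h := congrArg (ptr q) (L_ThetaStar (N := N) hq0)
  rwa [mul_assoc, mul_assoc, ptr_in2_mul, ← mul_assoc, ptr_RA_in2_SA hq0, ptr_mul_in2,
    ptr_SA_in2_RA hq0] at h

theorem ThetaStar_J_anticomm (hq0 : q ≠ 0) : J N q * tΘ = -(tΘ * J N q) := by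
  have h := congrArg (ptr q) (J_ThetaStar (N := N) hq0)
  rwa [mul_assoc, mul_assoc, ptr_in2_mul, ← mul_assoc, ptr_RA_in2_SA hq0, map_neg, ptr_mul_in2,
    ptr_SA_in2_RA hq0] at h

theorem ThetaStar_T_comm (hq0 : q ≠ 0) : tΘ * T N q = T N q * tΘ := by
  have h := congrArg (ptr q) (ThetaStar_T_rel (N := N) hq0)
  rwa [ptr_in1_mul_in2, mul_assoc, mul_assoc, ptr_in2_mul, ← mul_assoc, ptr_RA_in2_SA hq0] at h

theorem ThetaStar_om_anticomm (hq0 : q ≠ 0) :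
    om N q * tΘ + tΘ * om N q = -(q ^ (2 * N) • (W N q * Linv N q * Wbar N q)) := by
  have h := congrArg (ptr q) (om_ThetaStar (N := N) hq0)
  rw [mul_assoc, mul_assoc, ptr_in2_mul, ← mul_assoc, ptr_RA_in2_RA hq0, map_sub, map_neg,
    ← in2_mul, ptr_in2_mul_RA hq0, ptr_mul_in2, ptr_RA_in2_SA hq0] at h
  have h3 : ThetaStar N q = J N q * Linv N q * Wbar N q := rfl
  -- The partial trace produces `L⁻¹W̄` together with the correction `λωΘ*`; these combine into the
  -- symmetric product.
  have h4 : W N q * Linv N q * Wbar N q = Linv N q * Wbar N q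
      + lam q • (om N q * ThetaStar N q) := by
    rw [W, h3]
    simp only [add_mul, one_mul, smul_mul_assoc, mul_assoc]
  rw [h4]
  rw [mul_add, mul_smul_comm] at h
  linear_combination (norm := module) h

theorem J_L_comm (hq0 : q ≠ 0) : L N q * tJ = tJ * L N q := by
  have h1 : in2 (L N q) * RR * in2 (J N q) * SS = SS * in2 (J N q) * RR * in2 (L N q) := by
    calc in2 (L N q) * RR * in2 (J N q) * SS
        = (SS * RR) * in2 (L N q) * RR * in2 (J N q) * SS := by rw [SA_mul_RA hq0, one_mul]
      _ = SS * (RR * in2 (L N q) * RR * in2 (J N q)) * SS := by simp only [mul_assoc]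
      _ = SS * in2 (J N q) * RR * in2 (L N q) * (RR * SS) := by
          rw [← J_L_rel]; simp only [mul_assoc]
      _ = _ := by rw [RA_mul_SA hq0, mul_one]
  have h := congrArg (ptr q) h1
  rwa [mul_assoc, mul_assoc, ptr_in2_mul, ← mul_assoc, ptr_RA_in2_SA hq0, ptr_mul_in2,
    ptr_SA_in2_RA hq0] at h

theorem trq_J_J_anticomm (hq0 : q ≠ 0) :
    J N q * tJ + tJ * J N q = -((lam q * q ^ (2 * N)) • J N q ^ 2) := by
  have h := congrArg (ptr q) (J_J_rel N q)
  rw [mul_assoc, mul_assoc, ptr_in2_mul, ← mul_assoc, ptr_RA_in2_RA hq0, map_neg, ptr_mul_in2,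
    ptr_SA_in2_RA hq0, mul_add, mul_smul_comm, ← sq] at h
  linear_combination (norm := module) h

theorem trq_J_T (hq0 : q ≠ 0) :
    tJ * T N q = T N q * tJ + (lam q * q ^ (2 * N)) • (T N q * J N q) := by
  have h := congrArg (ptr q) (J_T_rel N q)
  rwa [ptr_in1_mul_in2, mul_assoc, mul_assoc, ptr_in2_mul, ← mul_assoc, ptr_RA_in2_RA hq0,
    mul_add, mul_smul_comm] at h

/-- The trace gives `1 + λωJ + λJω`. It is written as `WW̄ - λ²ωJ²ω` so that it can be subtracted
from the formula for `Tr_q(Θ*)`. -/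
theorem trq_J_om_anticomm (hq0 : q ≠ 0) :
    om N q * tJ + tJ * om N q
      = -(q ^ (2 * N) • (W N q * Wbar N q - lam q ^ 2 • (om N q * J N q ^ 2 * om N q))) := by
  have h := congrArg (ptr q) (om_J_rel N q)
  have h0 : RR * in2 (J N q) * RR * in2 (om N q) = (RR * in2 (J N q) * RR) * in2 (om N q) := rfl
  rw [map_add, ptr_mul_in2, mul_assoc, mul_assoc, ptr_in2_mul, ← mul_assoc, ptr_RA_in2_RA hq0,
    map_neg, ptr_RA hq0, mul_add, add_mul, mul_smul_comm, smul_mul_assoc] at h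
  have h4 : W N q * Wbar N q - lam q ^ 2 • (om N q * J N q ^ 2 * om N q)
      = 1 + lam q • (om N q * J N q) + lam q • (J N q * om N q) := by
    rw [W, Wbar, sq, sq]
    simp only [add_mul, mul_add, one_mul, mul_one, smul_mul_assoc, mul_smul_comm, mul_assoc]
    module
  rw [h4]
  linear_combination (norm := module) h

end commutation
end QGL
namespace QGL

/-! ### The formulas for `Q*` -/

section antiBRST

variable {K : Type*} [Field K] {N : ℕ} {q : K}

local notation "tΘ" => scal N (trq q (ThetaStar N q))
local notation "tJ" => scal N (trq q (J N q))

theorem scal_mul_apply {A : Type*} [Ring A] (t : A) (X : Matrix (Fin N) (Fin N) A) (i j : Fin N) :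
    (scal N t * X) i j = t * X i j := by
  rw [scal, Matrix.diagonal_mul]

theorem mul_scal_apply {A : Type*} [Ring A] (t : A) (X : Matrix (Fin N) (Fin N) A) (i j : Fin N) :
    (X * scal N t) i j = X i j * t := by
  rw [scal, Matrix.mul_diagonal]

theorem scal_Qstar : scal N (Qstar N q) = (lam q)⁻¹ • (tΘ - tJ) := by
  simp only [scal, Qstar]
  rw [Matrix.diagonal_sub, ← Matrix.diagonal_smul]
  rfl

theorem Qstar_eq (hq0 : q ≠ 0) (hq1 : q ^ 2 ≠ 1) :
    Qstar N q = trq q (J N q * ((lam q)⁻¹ • (Linv N q - 1))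
      + J N q * Linv N q * J N q * om N q) := by
  rw [Qstar, ← trq_sub, ← trq_smul, ThetaStar]
  congr 1
  have h := inv_mul_cancel₀ (lam_ne_zero hq0 hq1)
  simp only [mul_add, mul_one, mul_sub, mul_smul_comm, smul_sub, smul_add, smul_smul, h, one_smul,
    mul_assoc]
  abel

theorem Qstar_mul_self (hq0 : q ≠ 0) (hq1 : q ^ 2 ≠ 1) (hq2 : q ^ 2 ≠ -1) :
    Qstar N q * Qstar N q = 0 := by
  have h1 := trq_mul_self_eq_zero hq0 hq1 hq2 (J N q) (J_J_rel N q)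
  have h2 := trq_mul_self_eq_zero hq0 hq1 hq2 (ThetaStar N q) (ThetaStar_ThetaStar hq0)
  have h3 := congrArg (trq q) (ThetaStar_J_anticomm (N := N) hq0)
  rw [trq_mul_scal, trq_neg, trq_scal_mul] at h3
  simp only [Qstar, smul_mul_assoc, mul_smul_comm, sub_mul, mul_sub, h1, h2, h3]
  simp

theorem Qstar_L_comm (hq0 : q ≠ 0) :
    scal N (Qstar N q) * L N q - L N q * scal N (Qstar N q) = 0 := by
  simp only [scal_Qstar, smul_mul_assoc, mul_smul_comm, sub_mul, mul_sub, ThetaStar_L_comm hq0,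
    J_L_comm hq0, sub_self]

theorem Qstar_T_comm (hq0 : q ≠ 0) (hq1 : q ^ 2 ≠ 1) :
    scal N (Qstar N q) * T N q - T N q * scal N (Qstar N q)
      = -(q ^ (2 * N) • (T N q * J N q)) := by
  have h := inv_mul_cancel₀ (lam_ne_zero hq0 hq1)
  simp only [scal_Qstar, smul_mul_assoc, mul_smul_comm, sub_mul, mul_sub, ThetaStar_T_comm hq0,
    trq_J_T hq0, smul_add, smul_sub, smul_smul, ← mul_assoc (lam q)⁻¹, h, one_mul]
  abel

theorem Qstar_J_anticomm (hq0 : q ≠ 0) (hq1 : q ^ 2 ≠ 1) :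
    scal N (Qstar N q) * J N q + J N q * scal N (Qstar N q) = q ^ (2 * N) • J N q ^ 2 := by
  have h := inv_mul_cancel₀ (lam_ne_zero hq0 hq1)
  have e : scal N (Qstar N q) * J N q + J N q * scal N (Qstar N q)
      = (lam q)⁻¹ • ((J N q * tΘ + tΘ * J N q) - (J N q * tJ + tJ * J N q)) := by
    simp only [scal_Qstar, smul_mul_assoc, mul_smul_comm, sub_mul, mul_sub]
    module
  rw [e, ThetaStar_J_anticomm hq0, trq_J_J_anticomm hq0, neg_add_cancel, zero_sub, neg_neg,
    smul_smul, ← mul_assoc, h, one_mul]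

theorem Qstar_om_anticomm (hq0 : q ≠ 0) (hq1 : q ^ 2 ≠ 1) :
    scal N (Qstar N q) * om N q + om N q * scal N (Qstar N q)
      = q ^ (2 * N) • (W N q * ((lam q)⁻¹ • (1 - Linv N q)) * Wbar N q
            - lam q • (om N q * J N q ^ 2 * om N q)) := by
  have h := inv_mul_cancel₀ (lam_ne_zero hq0 hq1)
  have e : scal N (Qstar N q) * om N q + om N q * scal N (Qstar N q)
      = (lam q)⁻¹ • ((om N q * tΘ + tΘ * om N q) - (om N q * tJ + tJ * om N q)) := by
    simp only [scal_Qstar, smul_mul_assoc, mul_smul_comm, sub_mul, mul_sub]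
    module
  have h2 : (lam q)⁻¹ * lam q ^ 2 = lam q := by rw [sq, ← mul_assoc, h, one_mul]
  have h3 : lam q • (om N q * J N q ^ 2 * om N q)
      = (lam q)⁻¹ • (lam q ^ 2 • (om N q * J N q ^ 2 * om N q)) := by rw [smul_smul, h2]
  rw [e, ThetaStar_om_anticomm hq0, trq_J_om_anticomm hq0, h3]
  simp only [mul_smul_comm, smul_mul_assoc, mul_sub, sub_mul, mul_one]
  module

end antiBRST

/-! ### Parity automorphism, grading and the differential -/

section grading

variable {K : Type*} [Field K] (N : ℕ) (q : K)

/-- The sign of degree `n`. -/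
def sgn (K : Type*) [Field K] (n : ℤ) : K := (-1) ^ n

theorem sgn_add (m n : ℤ) : sgn K (m + n) = sgn K m * sgn K n :=
  zpow_add₀ (neg_ne_zero.mpr one_ne_zero) m n

theorem sgn_neg_one : sgn K (-1) = -1 := by
  rw [sgn, zpow_neg_one, inv_neg, inv_one]

/-- The grading involution on the free algebra, followed by the quotient map. -/
noncomputable def freeInvol : FreeAlgebra K (Gen N) →ₐ[K] DiffAlg N q :=
  FreeAlgebra.lift K fun g => sgn K g.deg • gen N q g

theorem freeInvol_matrix (s : K) (g : Fin N → Fin N → Gen N) (h : ∀ i j, sgn K (g i j).deg = s) :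
    (freeInvol N q).mapMatrix (Matrix.of fun i j => FreeAlgebra.ι K (g i j))
      = s • Matrix.of fun i j => gen N q (g i j) := by
  ext i j
  simp [freeInvol, h]

theorem freeInvol_T : (freeInvol N q).mapMatrix (freeT K N) = T N q :=
  (freeInvol_matrix N q 1 Gen.T fun _ _ => zpow_zero _).trans (one_smul _ _)

theorem freeInvol_Tinv : (freeInvol N q).mapMatrix (freeTinv K N) = Tinv N q :=
  (freeInvol_matrix N q 1 Gen.Tinv fun _ _ => zpow_zero _).trans (one_smul _ _)

theorem freeInvol_L : (freeInvol N q).mapMatrix (freeL K N) = L N q :=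
  (freeInvol_matrix N q 1 Gen.L fun _ _ => zpow_zero _).trans (one_smul _ _)

theorem freeInvol_Linv : (freeInvol N q).mapMatrix (freeLinv K N) = Linv N q :=
  (freeInvol_matrix N q 1 Gen.Linv fun _ _ => zpow_zero _).trans (one_smul _ _)

theorem freeInvol_om : (freeInvol N q).mapMatrix (freeOm K N) = (-1 : K) • om N q :=
  freeInvol_matrix N q (-1) Gen.om fun _ _ => zpow_one _

theorem freeInvol_J : (freeInvol N q).mapMatrix (freeJ K N) = (-1 : K) • J N q :=
  freeInvol_matrix N q (-1) Gen.J fun _ _ => sgn_neg_one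

/-- Each relation is homogeneous, so the signs on its two sides agree. The sign operator therefore
descends to the quotient, and the graded commutator becomes a linear map on all of it. -/
theorem freeInvol_rel {x y : FreeAlgebra K (Gen N)} (h : Rel N q x y) :
    freeInvol N q x = freeInvol N q y := by
  have entry : ∀ {m : Type} [Fintype m] [DecidableEq m] {X Y : Matrix m m (FreeAlgebra K (Gen N))}
      (_ : (freeInvol N q).mapMatrix X = (freeInvol N q).mapMatrix Y) (a b : m),
      freeInvol N q (X a b) = freeInvol N q (Y a b) := fun h a b => congrFun (congrFun h a) b
  cases h <;> refine entry ?_ _ _ <;>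
    simp only [map_mul, map_add, map_neg, map_one, mapMatrix_in1, mapMatrix_in2, mapMatrix_freeR,
      mapMatrix_freeRinv, freeInvol_T, freeInvol_Tinv, freeInvol_L, freeInvol_Linv, freeInvol_om,
      freeInvol_J, in1_smul, in2_smul, smul_mul_assoc, mul_smul_comm, smul_smul, neg_mul_neg,
      one_mul, one_smul]
  · exact om_om_rel N q
  · rw [om_L_rel]
  · exact om_J_rel N q
  · exact L_L_rel N q
  · rw [J_L_rel]
  · exact J_J_rel N q
  · exact T_T_rel N q
  · rw [om_T_rel]
  · rw [J_T_rel]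
  · exact L_T_rel N q
  · exact T_mul_Tinv N q
  · exact Tinv_mul_T N q
  · exact L_mul_Linv N q
  · exact Linv_mul_L N q

/-- The grading involution of the differential algebra. -/
noncomputable def invol : DiffAlg N q →ₐ[K] DiffAlg N q :=
  RingQuot.liftAlgHom K ⟨freeInvol N q, fun _ _ h => freeInvol_rel N q h⟩

theorem invol_gen (g : Gen N) : invol N q (gen N q g) = sgn K g.deg • gen N q g := by
  rw [invol, gen, RingQuot.liftAlgHom_mkAlgHom_apply]
  simp [freeInvol, gen]

theorem invol_word (w : List (Gen N)) : invol N q (w.map (gen N q)).prod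
    = sgn K (w.map Gen.deg).sum • (w.map (gen N q)).prod := by
  induction w with
  | nil => simp [sgn]
  | cons g w ih =>
    rw [List.map_cons, List.prod_cons, map_mul, ih, invol_gen, List.map_cons, List.sum_cons,
      sgn_add, smul_mul_smul_comm]

variable {N q}

theorem invol_of_homog {n : ℤ} {a : DiffAlg N q} (ha : a ∈ homog N q n) :
    invol N q a = sgn K n • a := by
  induction ha using Submodule.span_induction with
  | mem x hx =>
    obtain ⟨w, rfl, rfl⟩ := hx
    exact invol_word N q w
  | zero => simp
  | add x y _ _ hx hy => rw [map_add, hx, hy, smul_add]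
  | smul r x _ hx => rw [map_smul, hx, smul_comm]

theorem homog_mul {m n : ℤ} {a b : DiffAlg N q} (ha : a ∈ homog N q m) (hb : b ∈ homog N q n) :
    a * b ∈ homog N q (m + n) := by
  have h : homog N q m * homog N q n ≤ homog N q (m + n) := by
    rw [homog, homog, Submodule.span_mul_span, homog]
    refine Submodule.span_mono ?_
    rintro _ ⟨_, ⟨v, rfl, rfl⟩, _, ⟨w, rfl, rfl⟩, rfl⟩
    exact ⟨v ++ w, by simp, by simp⟩
  exact h (Submodule.mul_mem_mul ha hb)

theorem gen_mem_homog (g : Gen N) : gen N q g ∈ homog N q g.deg :=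
  Submodule.subset_span ⟨[g], by simp, by simp⟩

theorem one_mem_homog : (1 : DiffAlg N q) ∈ homog N q 0 :=
  Submodule.subset_span ⟨[], by simp, by simp⟩

/-- The span of all words in the generators is the whole algebra. -/
theorem span_words_eq_top :
    Submodule.span K (Set.range fun w : List (Gen N) => (w.map (gen N q)).prod) = ⊤ := by
  set S := Submodule.span K (Set.range fun w : List (Gen N) => (w.map (gen N q)).prod)
  have hw : ∀ w : List (Gen N), (w.map (gen N q)).prod ∈ S :=
    fun w => Submodule.subset_span ⟨w, rfl⟩
  have hS : S * S ≤ S := by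
    rw [Submodule.span_mul_span]
    refine Submodule.span_mono ?_
    rintro _ ⟨_, ⟨v, rfl⟩, _, ⟨w, rfl⟩, rfl⟩
    exact ⟨v ++ w, by simp⟩
  rw [eq_top_iff]
  rintro x -
  obtain ⟨y, rfl⟩ := RingQuot.mkAlgHom_surjective K (Rel N q) x
  induction y using FreeAlgebra.induction with
  | grade0 r =>
    rw [AlgHom.commutes, Algebra.algebraMap_eq_smul_one]
    exact S.smul_mem r (by simpa using hw [])
  | grade1 g => simpa [gen] using hw [g]
  | mul a b ha hb => rw [map_mul]; exact hS (Submodule.mul_mem_mul ha hb)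
  | add a b ha hb => rw [map_add]; exact S.add_mem ha hb

/-- Words are homogeneous and span, which is enough; that the sum of the graded pieces is direct
plays no role. -/
theorem linearMap_ext_homog {f g : DiffAlg N q →ₗ[K] DiffAlg N q}
    (h : ∀ n : ℤ, ∀ a ∈ homog N q n, f a = g a) : f = g := by
  exact LinearMap.ext_on_range span_words_eq_top fun w =>
    h (w.map Gen.deg).sum _ (Submodule.subset_span ⟨w, rfl, rfl⟩)

theorem matrix_mul_mem_homog {m n k : ℤ} {X Y : Matrix (Fin N) (Fin N) (DiffAlg N q)}
    (hk : m + n = k) (hX : ∀ i j, X i j ∈ homog N q m) (hY : ∀ i j, Y i j ∈ homog N q n) (i j : Fin N) :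
    (X * Y) i j ∈ homog N q k := by
  rw [Matrix.mul_apply, ← hk]
  exact Submodule.sum_mem _ fun k _ => homog_mul (hX i k) (hY k j)

theorem trq_mem_homog {n : ℤ} {X : Matrix (Fin N) (Fin N) (DiffAlg N q)}
    (hX : ∀ i j, X i j ∈ homog N q n) : trq q X ∈ homog N q n := by
  rw [trq_eq_sum]
  exact Submodule.sum_mem _ fun k _ => Submodule.smul_mem _ _ (hX k k)

theorem Qstar_mem_homog : Qstar N q ∈ homog N q (-1) := by
  have hJ : ∀ i j, J N q i j ∈ homog N q (-1) := fun i j => gen_mem_homog (Gen.J i j)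
  have hom : ∀ i j, om N q i j ∈ homog N q 1 := fun i j => gen_mem_homog (Gen.om i j)
  have hL : ∀ i j, Linv N q i j ∈ homog N q 0 := fun i j => gen_mem_homog (Gen.Linv i j)
  have hW : ∀ i j, Wbar N q i j ∈ homog N q 0 := fun i j => by
    have h1 : (1 : Matrix (Fin N) (Fin N) (DiffAlg N q)) i j ∈ homog N q 0 := by
      rw [Matrix.one_apply]
      split_ifs
      · exact one_mem_homog
      · exact Submodule.zero_mem _
    have h2 : (J N q * om N q) i j ∈ homog N q 0 := matrix_mul_mem_homog (by norm_num) hJ hom i j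
    rw [Wbar, Matrix.add_apply, Matrix.smul_apply]
    exact Submodule.add_mem _ h1 (Submodule.smul_mem _ _ h2)
  have hΘ : ∀ i j, ThetaStar N q i j ∈ homog N q (-1) := by
    have h : ∀ i j, (J N q * Linv N q) i j ∈ homog N q (-1) :=
      matrix_mul_mem_homog (by norm_num) hJ hL
    exact matrix_mul_mem_homog (by norm_num) h hW
  rw [Qstar]
  exact Submodule.smul_mem _ _ (Submodule.sub_mem _ (trq_mem_homog hΘ) (trq_mem_homog hJ))

/-- The graded commutator with `Q*`. -/
noncomputable def dstar : DiffAlg N q →ₗ[K] DiffAlg N q :=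
  LinearMap.mulLeft K (Qstar N q) - LinearMap.mulRight K (Qstar N q) ∘ₗ (invol N q).toLinearMap

theorem dstar_apply (a : DiffAlg N q) :
    dstar a = Qstar N q * a - invol N q a * Qstar N q := rfl

theorem dstar_homog {n : ℤ} {a : DiffAlg N q} (ha : a ∈ homog N q n) :
    dstar a = Qstar N q * a - sgn K n • (a * Qstar N q) := by
  rw [dstar_apply, invol_of_homog ha, smul_mul_assoc]

theorem dstar_mem_homog {n : ℤ} {a : DiffAlg N q} (ha : a ∈ homog N q n) :
    dstar a ∈ homog N q (n - 1) := by
  rw [dstar_homog ha]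
  refine Submodule.sub_mem _ ?_ (Submodule.smul_mem _ _ (homog_mul ha Qstar_mem_homog))
  rw [sub_eq_add_neg, add_comm]
  exact homog_mul Qstar_mem_homog ha

theorem dstar_mul {n : ℤ} {a : DiffAlg N q} (ha : a ∈ homog N q n) (b : DiffAlg N q) :
    dstar (a * b) = dstar a * b + sgn K n • (a * dstar b) := by
  simp only [dstar_apply, map_mul, invol_of_homog ha, sub_mul, mul_sub, smul_mul_assoc,
    smul_sub, mul_assoc]
  abel

theorem dstar_dstar (hQ : Qstar N q * Qstar N q = 0) (a : DiffAlg N q) : dstar (dstar a) = 0 := by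
  have h : (dstar ∘ₗ dstar : DiffAlg N q →ₗ[K] DiffAlg N q) = 0 := by
    refine linearMap_ext_homog fun n a ha => ?_
    -- Since `dstar` shifts the parity, the two mixed terms `Q* a Q*` have opposite signs and
    -- cancel; the other two contain `(Q*)²`.
    have hs : sgn K (n - 1) = -sgn K n := by
      rw [sub_eq_add_neg, sgn_add, sgn_neg_one, mul_neg_one]
    rw [LinearMap.comp_apply, dstar_homog (dstar_mem_homog ha), dstar_homog ha, hs]
    simp only [mul_sub, sub_mul, ← mul_assoc, mul_smul_comm, smul_mul_assoc, hQ, zero_mul]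
    rw [mul_assoc a, hQ, mul_zero, LinearMap.zero_apply]
    module
  exact LinearMap.congr_fun h a

end grading
end QGL

theorem mainTheorem4 {K : Type*} [Field K] (N : ℕ) (q : K)
    (hq0 : q ≠ 0) (hq1 : q ^ 2 ≠ 1) (hq2 : q ^ 2 ≠ -1) :
    -- the two expressions for the anti-BRST operator agree
    QGL.Qstar N q = QGL.trq q
      (QGL.J N q * ((QGL.lam q)⁻¹ • (QGL.Linv N q - 1))
        + QGL.J N q * QGL.Linv N q * QGL.J N q * QGL.om N q) ∧
    -- nilpotency
    QGL.Qstar N q * QGL.Qstar N q = 0 ∧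
    -- commutator with `L`
    (∀ i j, QGL.Qstar N q * QGL.L N q i j - QGL.L N q i j * QGL.Qstar N q = 0) ∧
    -- commutator with `T`
    (∀ i j, QGL.Qstar N q * QGL.T N q i j - QGL.T N q i j * QGL.Qstar N q
      = -(q ^ (2 * N) • (QGL.T N q * QGL.J N q) i j)) ∧
    -- anticommutator with `J`
    (∀ i j, QGL.Qstar N q * QGL.J N q i j + QGL.J N q i j * QGL.Qstar N q
      = q ^ (2 * N) • (QGL.J N q ^ 2) i j) ∧
    -- anticommutator with `ω`
    (∀ i j, QGL.Qstar N q * QGL.om N q i j + QGL.om N q i j * QGL.Qstar N q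
      = q ^ (2 * N) •
          (QGL.W N q * ((QGL.lam q)⁻¹ • (1 - QGL.Linv N q)) * QGL.Wbar N q
            - QGL.lam q • (QGL.om N q * QGL.J N q ^ 2 * QGL.om N q) :
            Matrix (Fin N) (Fin N) (QGL.DiffAlg N q)) i j) ∧
    -- the graded commutator with `Q*` defines a differential of degree `-1`
    (∃! d : QGL.DiffAlg N q →ₗ[K] QGL.DiffAlg N q,
      (∀ n : ℤ, ∀ a ∈ QGL.homog N q n,
        d a = QGL.Qstar N q * a - ((-1 : K) ^ n) • (a * QGL.Qstar N q)) ∧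
      (∀ a, d (d a) = 0) ∧
      (∀ n : ℤ, ∀ a ∈ QGL.homog N q n, ∀ b, d (a * b) = d a * b + ((-1 : K) ^ n) • (a * d b)) ∧
      (∀ n : ℤ, ∀ a ∈ QGL.homog N q n, d a ∈ QGL.homog N q (n - 1))) := by
  refine ⟨QGL.Qstar_eq hq0 hq1, QGL.Qstar_mul_self hq0 hq1 hq2, fun i j => ?_, fun i j => ?_,
    fun i j => ?_, fun i j => ?_, QGL.dstar, ⟨fun n a ha => QGL.dstar_homog ha,
      QGL.dstar_dstar (QGL.Qstar_mul_self hq0 hq1 hq2), fun n a ha => QGL.dstar_mul ha,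
      fun n a ha => QGL.dstar_mem_homog ha⟩, fun d hd => ?_⟩
  · rw [← QGL.scal_mul_apply, ← QGL.mul_scal_apply, ← Matrix.sub_apply, QGL.Qstar_L_comm hq0]
    rfl
  · rw [← QGL.scal_mul_apply, ← QGL.mul_scal_apply, ← Matrix.sub_apply,
      QGL.Qstar_T_comm hq0 hq1]
    rfl
  · rw [← QGL.scal_mul_apply, ← QGL.mul_scal_apply, ← Matrix.add_apply,
      QGL.Qstar_J_anticomm hq0 hq1]
    rfl
  · rw [← QGL.scal_mul_apply, ← QGL.mul_scal_apply, ← Matrix.add_apply,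
      QGL.Qstar_om_anticomm hq0 hq1]
    rfl
  -- The graded commutator formula alone determines the map.
  · exact QGL.linearMap_ext_homog fun n a ha => (hd.1 n a ha).trans (QGL.dstar_homog ha).symm
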